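/- Let $1\le k\le n$, let $\rho_k,\ldots,\rho_n,\rho_{n+1}>0$, and let $F$ be either a probability distribution function on $\mathbb{R}$ with $F(0)=0$, or the symbol $[0]$ (``permanent input''). An on-off system with input interval distribution $F$ and recovery rates $\rho_N,\ldots,\rho_k$ is the following. There are nodes $k,\ldots,N$, all switched off at time $0$. Input signals are sent to node $N$ at the times $T_i=\tau_1+\cdots+\tau_i$, $i\ge 1$, where the $\tau_j$ are i.i.d. with distribution function $F$. A node $i$ that is switched off stays off for an exponentially distributed time with mean $1/\rho_i$ (its recovery time) and is then on; all recovery times are independent of each other and of the $\tau_j$. A signal sent to node $i$ while it is on is received by it: node $i$ is switched off at once and the signal is sent on, instantaneously, to node $i-1$; a signal sent to a node that is off is lost. If $F=[0]$, then instead node $N$ receives a signal immediately after each of its recoveries. The successive reception times of node $k$ form a renewal process, and $F_{(\rho_N,\ldots,\rho_k)}$ denotes its interval distribution function, i.e. the distribution function of the first time at which node $k$ receives a signal. Then adding an extra node with rate $\rho_{n+1}$ at the input end stochastically enlarges the interreception distribution of node $k$: $$F_{(\rho_{n+1},\rho_n,\ldots,\rho_k)}\succeq F_{(\rho_n,\ldots,\rho_k)},$$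 that is, $F_{(\rho_{n+1},\rho_n,\ldots,\rho_k)}(x)\le F_{(\rho_n,\ldots,\rho_k)}(x)$ for every $x\in\mathbb{R}$. -/

import Mathlib

open MeasureTheory ProbabilityTheory

namespace OnOff

noncomputable section

/-- The input times `T 0 = 0`, `T i = τ₁ + ⋯ + τᵢ` of a renewal process whose consecutive
intervals are `τ 0, τ 1, …`. -/
def inputTimes (τ : ℕ → ℝ) (i : ℕ) : ℝ := ∑ j ∈ Finset.range i, τ j

/-- Reception times of a single node. Signals are sent to the node at the times `T 0, T 1, …`,
and `e j` is the length of its `(j+1)`-st off-period (recovery time). The node is off at time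
`0` (zeroth reception time). After its `j`-th reception at time `s` it is off during
`[s, s + e j)`, becomes on at time `s + e j`, and it receives (i.e. it is switched off by) the
first signal sent to it after time `s + e j`. -/
def nodeReceptions (T e : ℕ → ℝ) : ℕ → ℝ
  | 0 => 0
  | j + 1 => sInf {s : ℝ | (∃ l, s = T l) ∧ nodeReceptions T e j + e j < s}

/-- Reception times of the last (leftmost) node of a line of `m` nodes. Node `0 : Fin m` is the
node at the input end; signals are sent to it at the times `T 0, T 1, …`, and each other node is
sent precisely the signals that its predecessor receives. The row `e i` lists the recovery times
of node `i`. -/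
def lastReceptions : {m : ℕ} → (T : ℕ → ℝ) → (e : Fin m → ℕ → ℝ) → ℕ → ℝ
  | 0, T, _ => T
  | _ + 1, T, e => lastReceptions (nodeReceptions T (e 0)) (Fin.tail e)

/-- Reception times of the last node of a line of `m + 1` nodes with permanent input: the node
`0` at the input end receives a signal immediately after each of its recoveries, so that its
reception times are the partial sums of its recovery times; these signals are passed on to the
other `m` nodes. -/
def permanentLastReceptions {m : ℕ} (e : Fin (m + 1) → ℕ → ℝ) : ℕ → ℝ :=
  lastReceptions (fun j => ∑ l ∈ Finset.range j, e 0 l) (Fin.tail e)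

/-- Joint law of all the recovery times: independent, exponential with rate `ρ i` at node `i`. -/
def recoveryLaw {m : ℕ} (ρ : Fin m → ℝ) : Measure (Fin m → ℕ → ℝ) :=
  Measure.pi fun i => Measure.infinitePi fun _ : ℕ => expMeasure (ρ i)

/-- Joint law of the input intervals, i.i.d. with distribution `F`, and of all the recovery times,
independent of the input intervals. -/
def systemLaw (F : Measure ℝ) {m : ℕ} (ρ : Fin m → ℝ) :
    Measure ((ℕ → ℝ) × (Fin m → ℕ → ℝ)) :=
  (Measure.infinitePi fun _ : ℕ => F).prod (recoveryLaw ρ)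

/-- `F_(ρ 0, ρ 1, …, ρ (m-1))`: the interreception time distribution of the last node of the
on-off system with input interval distribution `F` and recovery rates `ρ 0, …, ρ (m-1)`, listed
from the input end, i.e. the distribution of the first reception time of that node. -/
def interreception (F : Measure ℝ) {m : ℕ} (ρ : Fin m → ℝ) : Measure ℝ :=
  (systemLaw F ρ).map fun ω => lastReceptions (inputTimes ω.1) ω.2 1

/-- `[0]_(ρ 0, ρ 1, …, ρ m)`: the interreception time distribution of the last node of the
on-off system with permanent input and recovery rates `ρ 0, …, ρ m`, listed from the input end. -/
def permanentInterreception {m : ℕ} (ρ : Fin (m + 1) → ℝ) : Measure ℝ :=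
  (recoveryLaw ρ).map fun e => permanentLastReceptions e 1

/-- `μ ⪯ ν`: the distribution `ν` stochastically dominates the distribution `μ`. -/
def StochLE (μ ν : Measure ℝ) : Prop := ∀ x : ℝ, cdf ν x ≤ cdf μ x

/-! The reception times are measurable functions of the input intervals and the recovery times,
so that the two distributions above are probability measures. -/

theorem measurable_nodeReceptions {Ω : Type*} [MeasurableSpace Ω] {T e : Ω → ℕ → ℝ}
    (hT : Measurable T) (he : Measurable e) :
    Measurable fun ω => nodeReceptions (T ω) (e ω) := by
  have hT' : ∀ l, Measurable fun ω => T ω l := fun l => (measurable_pi_apply l).comp hT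
  have he' : ∀ l, Measurable fun ω => e ω l := fun l => (measurable_pi_apply l).comp he
  refine measurable_pi_iff.2 fun j => ?_
  induction j with
  | zero => exact measurable_const
  | succ j ih =>
    have hR : Measurable fun ω => nodeReceptions (T ω) (e ω) j + e ω j := ih.add (he' j)
    refine measurable_of_Iio fun x => ?_
    have hset : (fun ω => nodeReceptions (T ω) (e ω) (j + 1)) ⁻¹' Set.Iio x =
        {ω | (∀ l, T ω l ≤ nodeReceptions (T ω) (e ω) j + e ω j) ∧ 0 < x} ∪
        {ω | ∃ l, nodeReceptions (T ω) (e ω) j + e ω j < T ω l ∧ T ω l < x} := by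
      ext ω
      simp only [Set.mem_preimage, Set.mem_Iio, Set.mem_union, Set.mem_ofPred_eq, nodeReceptions]
      by_cases h : ∃ l, nodeReceptions (T ω) (e ω) j + e ω j < T ω l
      · have hne : {s : ℝ | (∃ l, s = T ω l) ∧
            nodeReceptions (T ω) (e ω) j + e ω j < s}.Nonempty := by
          obtain ⟨l, hl⟩ := h
          exact ⟨T ω l, ⟨l, rfl⟩, hl⟩
        have hbd : BddBelow {s : ℝ | (∃ l, s = T ω l) ∧
            nodeReceptions (T ω) (e ω) j + e ω j < s} := ⟨_, fun s hs => hs.2.le⟩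
        rw [csInf_lt_iff hbd hne]
        constructor
        · rintro ⟨s, ⟨⟨l, rfl⟩, h1⟩, h2⟩
          exact Or.inr ⟨l, h1, h2⟩
        · rintro (⟨h1, -⟩ | ⟨l, h1, h2⟩)
          · obtain ⟨l, hl⟩ := h
            exact absurd (h1 l) (not_le.2 hl)
          · exact ⟨T ω l, ⟨⟨l, rfl⟩, h1⟩, h2⟩
      · have hemp : {s : ℝ | (∃ l, s = T ω l) ∧
            nodeReceptions (T ω) (e ω) j + e ω j < s} = ∅ := by
          ext s
          simp only [Set.mem_ofPred_eq, Set.mem_empty_iff_false, iff_false]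
          rintro ⟨⟨l, rfl⟩, h1⟩
          exact h ⟨l, h1⟩
        rw [hemp, Real.sInf_empty]
        push Not at h
        constructor
        · intro hx
          exact Or.inl ⟨h, hx⟩
        · rintro (⟨-, h2⟩ | ⟨l, h1, -⟩)
          · exact h2
          · exact absurd (h l) (not_le.2 h1)
    rw [hset]
    refine MeasurableSet.union ?_ ?_
    · refine MeasurableSet.inter ?_ (MeasurableSet.const _)
      change MeasurableSet {ω | ∀ l, T ω l ≤ nodeReceptions (T ω) (e ω) j + e ω j}
      rw [Set.ofPred_forall]
      exact MeasurableSet.iInter fun l => measurableSet_le (hT' l) hR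
    · rw [Set.ofPred_exists]
      exact MeasurableSet.iUnion fun l =>
        (measurableSet_lt hR (hT' l)).inter (measurableSet_lt (hT' l) measurable_const)

theorem measurable_lastReceptions {Ω : Type*} [MeasurableSpace Ω] {m : ℕ} {T : Ω → ℕ → ℝ}
    {e : Ω → Fin m → ℕ → ℝ} (hT : Measurable T) (he : Measurable e) :
    Measurable fun ω => lastReceptions (T ω) (e ω) := by
  induction m generalizing T with
  | zero => exact hT
  | succ m ih =>
    refine ih (measurable_nodeReceptions hT ((measurable_pi_apply 0).comp he)) ?_
    exact measurable_pi_iff.2 fun i => (measurable_pi_apply i.succ).comp he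

theorem measurable_lastReceptions_inputTimes {m : ℕ} (j : ℕ) :
    Measurable fun ω : (ℕ → ℝ) × (Fin m → ℕ → ℝ) =>
      lastReceptions (inputTimes ω.1) ω.2 j := by
  refine (measurable_pi_apply j).comp (measurable_lastReceptions ?_ measurable_snd)
  refine measurable_pi_iff.2 fun i => ?_
  unfold inputTimes
  fun_prop

theorem measurable_permanentLastReceptions {m : ℕ} (j : ℕ) :
    Measurable fun e : Fin (m + 1) → ℕ → ℝ => permanentLastReceptions e j := by
  refine (measurable_pi_apply j).comp (measurable_lastReceptions ?_ ?_)
  · refine measurable_pi_iff.2 fun i => ?_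
    fun_prop
  · exact measurable_pi_iff.2 fun i => measurable_pi_apply i.succ

theorem isProbabilityMeasure_recoveryLaw {m : ℕ} {ρ : Fin m → ℝ} (hρ : ∀ i, 0 < ρ i) :
    IsProbabilityMeasure (recoveryLaw ρ) := by
  have h : ∀ i, IsProbabilityMeasure (expMeasure (ρ i)) :=
    fun i => isProbabilityMeasure_expMeasure (hρ i)
  unfold recoveryLaw
  infer_instance

theorem isProbabilityMeasure_interreception (F : Measure ℝ) [IsProbabilityMeasure F] {m : ℕ}
    {ρ : Fin m → ℝ} (hρ : ∀ i, 0 < ρ i) : IsProbabilityMeasure (interreception F ρ) := by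
  have := isProbabilityMeasure_recoveryLaw hρ
  have : IsProbabilityMeasure (systemLaw F ρ) := by unfold systemLaw; infer_instance
  exact Measure.isProbabilityMeasure_map (measurable_lastReceptions_inputTimes 1).aemeasurable

theorem isProbabilityMeasure_permanentInterreception {m : ℕ} {ρ : Fin (m + 1) → ℝ}
    (hρ : ∀ i, 0 < ρ i) : IsProbabilityMeasure (permanentInterreception ρ) := by
  have := isProbabilityMeasure_recoveryLaw hρ
  exact Measure.isProbabilityMeasure_map (measurable_permanentLastReceptions 1).aemeasurable

end

end OnOff

open scoped ENNReal BoundedContinuousFunction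

namespace OnOff

/-! A single node with rate `ρ` turns a renewal input with interval law `F` into a renewal process
with interval law `nodeLaw F ρ`, because the node and its input start afresh at each reception
(`measurePreserving_intervals`). So the nodes of a line act one after another as operators on
interval laws (`interreception_cons`).

At the output end domination is evident path by path: a node cannot receive before the first signal
is sent to it (`stochLE_nodeLaw`). The extra node sits at the input end, but it can be moved,
because the operators commute. With `φ = laplace F` and `ψ = laplace (nodeLaw F ρ)`, summing over
the index of the first received signal gives `1 - ψ s = (1 - φ s) / (1 - φ (s + ρ))`
(`one_sub_laplace_nodeLaw`). Two nodes with rates `a` and `b` then produce an expression symmetric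
in `a` and `b`, and uniqueness of Laplace transforms yields `nodeLaw_comm`. Induction on the number
of nodes pushes the extra node to the output end.

With permanent input the first node emits a renewal process with exponential intervals, which
reduces this case to the previous one. Only the exchange of the first two nodes needs its own
computation (`nodeLaw_expMeasure_comm`). -/

/-! ### Sample paths of a single node. -/

/-- The sequence `x` with its first `k` terms dropped. -/
def shift (k : ℕ) (x : ℕ → ℝ) (i : ℕ) : ℝ := x (i + k)

/-- The first `k` terms of `x`, followed by `y`. -/
def concat (k : ℕ) (x y : ℕ → ℝ) (i : ℕ) : ℝ := if i < k then x i else y (i - k)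

/-- Sequences of positive intervals whose sum is infinite. -/
def IsInput (τ : ℕ → ℝ) : Prop := (∀ i, 0 < τ i) ∧ ∀ M : ℝ, ∃ l, M < inputTimes τ l

/-- The first signal that finds the node on is the one sent at the time `T (l + 1)`. -/
def FirstReceived (l : ℕ) (τ : ℕ → ℝ) (u : ℝ) : Prop :=
  inputTimes τ l ≤ u ∧ u < inputTimes τ (l + 1)

lemma shift_concat (k : ℕ) (x y : ℕ → ℝ) : shift k (concat k x y) = y := by
  ext i; simp [shift, concat]

lemma inputTimes_zero (τ : ℕ → ℝ) : inputTimes τ 0 = 0 := by simp [inputTimes]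

lemma inputTimes_succ (τ : ℕ → ℝ) (l : ℕ) : inputTimes τ (l + 1) = inputTimes τ l + τ l :=
  Finset.sum_range_succ _ _

lemma inputTimes_concat {k l : ℕ} (h : l ≤ k) (x y : ℕ → ℝ) :
    inputTimes (concat k x y) l = inputTimes x l := by
  refine Finset.sum_congr rfl fun i hi => ?_
  have : i < k := (Finset.mem_range.1 hi).trans_le h
  simp [concat, this]

lemma firstReceived_concat (l : ℕ) (x y : ℕ → ℝ) (u : ℝ) :
    FirstReceived l (concat (l + 1) x y) u ↔ FirstReceived l x u := by
  simp [FirstReceived, inputTimes_concat]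

lemma inputTimes_add (τ : ℕ → ℝ) (k i : ℕ) :
    inputTimes τ (i + k) = inputTimes τ k + inputTimes (shift k τ) i := by
  rw [add_comm i k, inputTimes, Finset.sum_range_add]
  simp [inputTimes, shift, add_comm]

lemma inputTimes_strictMono {τ : ℕ → ℝ} (h : ∀ i, 0 < τ i) : StrictMono (inputTimes τ) :=
  strictMono_nat_of_lt_succ fun n => by rw [inputTimes_succ]; linarith [h n]

lemma inputTimes_nonneg {τ : ℕ → ℝ} (h : ∀ i, 0 < τ i) (l : ℕ) : 0 ≤ inputTimes τ l :=
  Finset.sum_nonneg fun i _ => (h i).le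

lemma IsInput.shift {τ : ℕ → ℝ} (h : IsInput τ) (k : ℕ) : IsInput (shift k τ) := by
  refine ⟨fun i => h.1 _, fun M => ?_⟩
  obtain ⟨l, hl⟩ := h.2 (M + inputTimes τ k)
  refine ⟨l, ?_⟩
  have := (inputTimes_strictMono h.1).monotone (Nat.le_add_right l k)
  rw [inputTimes_add] at this
  linarith

lemma IsInput.existsUnique_firstReceived {τ : ℕ → ℝ} (h : IsInput τ) {u : ℝ} (hu : 0 ≤ u) :
    ∃! l, FirstReceived l τ u := by
  classical
  have hex := h.2 u
  have h0 : Nat.find hex ≠ 0 := fun h0 => by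
    have := Nat.find_spec hex
    rw [h0, inputTimes_zero] at this
    exact absurd this (not_lt.2 hu)
  obtain ⟨l, hl⟩ := Nat.exists_eq_succ_of_ne_zero h0
  refine ⟨l, ⟨not_lt.1 (Nat.find_min hex (by omega)), ?_⟩, fun k hk => ?_⟩
  · have := Nat.find_spec hex
    rwa [hl] at this
  · have h1 := Nat.find_spec hex
    rw [hl] at h1
    have h2 : u < inputTimes τ (k + 1) := hk.2
    have hm := inputTimes_strictMono h.1
    have h3 : k < l + 1 := hm.lt_iff_lt.1 (hk.1.trans_lt h1)
    have h4 : inputTimes τ l ≤ u := not_lt.1 (Nat.find_min hex (by omega))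
    have h5 : l < k + 1 := hm.lt_iff_lt.1 (h4.trans_lt h2)
    omega

lemma nodeReceptions_nonneg {T : ℕ → ℝ} (hT : ∀ l, 0 ≤ T l) (e : ℕ → ℝ) (j : ℕ) :
    0 ≤ nodeReceptions T e j := by
  cases j with
  | zero => exact le_rfl
  | succ j =>
    refine Real.sInf_nonneg ?_
    rintro s ⟨⟨l, rfl⟩, -⟩
    exact hT l

lemma nodeReceptions_one {τ e : ℕ → ℝ} (h : ∀ i, 0 < τ i) {l : ℕ}
    (hl : FirstReceived l τ (e 0)) :
    nodeReceptions (inputTimes τ) e 1 = inputTimes τ (l + 1) := by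
  refine IsLeast.csInf_eq ⟨⟨⟨_, rfl⟩, by simpa [nodeReceptions] using hl.2⟩, ?_⟩
  rintro s ⟨⟨k, rfl⟩, hk⟩
  have hm := inputTimes_strictMono h
  simp only [nodeReceptions, zero_add] at hk
  exact hm.monotone (hm.lt_iff_lt.1 (hl.1.trans_lt hk))

/-- Pathwise regeneration: the first reception uses up `l + 1` input intervals and one recovery
time, and leaves the node off, as at time `0`. What follows is the same system run on the remaining
data, translated in time. -/
lemma nodeReceptions_succ_eq {τ e : ℕ → ℝ} (h : IsInput τ) (he : ∀ j, 0 ≤ e j) {l : ℕ}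
    (hl : FirstReceived l τ (e 0)) (j : ℕ) :
    nodeReceptions (inputTimes τ) e (j + 1) = inputTimes τ (l + 1) +
      nodeReceptions (inputTimes (shift (l + 1) τ)) (shift 1 e) j := by
  induction j with
  | zero => simpa [nodeReceptions] using nodeReceptions_one h.1 hl
  | succ j ih =>
    have hs := h.shift (l + 1)
    rw [nodeReceptions, ih]
    conv_rhs => rw [nodeReceptions]
    set R := nodeReceptions (inputTimes (shift (l + 1) τ)) (shift 1 e) j with hR
    have hR0 : 0 ≤ R := nodeReceptions_nonneg (inputTimes_nonneg hs.1) _ _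
    have hset : {s : ℝ | (∃ k, s = inputTimes τ k) ∧ inputTimes τ (l + 1) + R + e (j + 1) < s} =
        (fun x => inputTimes τ (l + 1) + x) '' {s : ℝ | (∃ k, s = inputTimes (shift (l + 1) τ) k) ∧
          R + shift 1 e j < s} := by
      ext s
      simp only [Set.mem_ofPred_eq, Set.mem_image]
      constructor
      · rintro ⟨⟨k, rfl⟩, hk⟩
        have hlt : inputTimes τ (l + 1) < inputTimes τ k := by linarith [he (j + 1)]
        have := (inputTimes_strictMono h.1).lt_iff_lt.1 hlt
        obtain ⟨i, rfl⟩ := Nat.exists_eq_add_of_le' this.le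
        rw [inputTimes_add τ (l + 1) i] at hk ⊢
        exact ⟨_, ⟨⟨i, rfl⟩, by simp only [shift] at hk ⊢; linarith⟩, rfl⟩
      · rintro ⟨_, ⟨⟨i, rfl⟩, hi⟩, rfl⟩
        refine ⟨⟨i + (l + 1), (inputTimes_add _ _ _).symm⟩, ?_⟩
        simp only [shift] at hi ⊢
        linarith
    rw [hset]
    refine ((OrderIso.addLeft (inputTimes τ (l + 1))).map_csInf' ?_
      ⟨R + shift 1 e j, fun s hs => hs.2.le⟩).symm
    -- Unboundedness of the input times is essential here: the default `sInf ∅ = 0` would not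
    -- commute with the translation.
    obtain ⟨k, hk⟩ := hs.2 (R + shift 1 e j)
    exact ⟨_, ⟨k, rfl⟩, hk⟩

/-- The intervals between the successive receptions of a node. -/
noncomputable def intervals (τ e : ℕ → ℝ) (j : ℕ) : ℝ :=
  nodeReceptions (inputTimes τ) e (j + 1) - nodeReceptions (inputTimes τ) e j

lemma inputTimes_intervals (τ e : ℕ → ℝ) :
    inputTimes (intervals τ e) = nodeReceptions (inputTimes τ) e := by
  ext j
  rw [inputTimes]
  simp only [intervals]
  rw [Finset.sum_range_sub]
  simp [nodeReceptions]

lemma intervals_zero (τ e : ℕ → ℝ) :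
    intervals τ e 0 = nodeReceptions (inputTimes τ) e 1 := by
  simp [intervals, nodeReceptions]

lemma intervals_succ {τ e : ℕ → ℝ} (h : IsInput τ) (he : ∀ j, 0 ≤ e j) {l : ℕ}
    (hl : FirstReceived l τ (e 0)) (j : ℕ) :
    intervals τ e (j + 1) = intervals (shift (l + 1) τ) (shift 1 e) j := by
  simp only [intervals]
  rw [nodeReceptions_succ_eq h he hl, nodeReceptions_succ_eq h he hl]
  ring

/-! ### Measurability and product measures. -/

lemma measurable_shift (k : ℕ) : Measurable (shift k) :=
  measurable_pi_iff.2 fun i => measurable_pi_apply (i + k)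

lemma measurable_inputTimes : Measurable inputTimes := by
  refine measurable_pi_iff.2 fun i => ?_
  unfold inputTimes
  fun_prop

lemma measurable_inputTimes_apply (l : ℕ) : Measurable fun τ => inputTimes τ l :=
  (measurable_pi_apply l).comp measurable_inputTimes

lemma measurable_concat (k : ℕ) :
    Measurable fun p : (ℕ → ℝ) × (ℕ → ℝ) => concat k p.1 p.2 := by
  refine measurable_pi_iff.2 fun i => ?_
  unfold concat
  split_ifs <;> fun_prop

lemma measurable_intervals :
    Measurable fun p : (ℕ → ℝ) × (ℕ → ℝ) => intervals p.1 p.2 := by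
  have h := measurable_nodeReceptions (T := fun p : (ℕ → ℝ) × (ℕ → ℝ) => inputTimes p.1)
    (measurable_inputTimes.comp measurable_fst) measurable_snd
  exact measurable_pi_iff.2 fun j =>
    ((measurable_pi_apply (j + 1)).comp h).sub ((measurable_pi_apply j).comp h)

lemma measurableSet_firstReceived (l : ℕ) :
    MeasurableSet {p : (ℕ → ℝ) × (ℕ → ℝ) | FirstReceived l p.1 (p.2 0)} := by
  have h0 : Measurable fun p : (ℕ → ℝ) × (ℕ → ℝ) => p.2 0 := by fun_prop
  exact (measurableSet_le ((measurable_inputTimes_apply l).comp measurable_fst) h0).inter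
    (measurableSet_lt h0 ((measurable_inputTimes_apply (l + 1)).comp measurable_fst))

/-- Independence of past and future in usable form: the tail of an i.i.d. sequence may be replaced
by an independent copy. On boxes, the coordinates split at `k` into two disjoint groups. -/
lemma measurePreserving_concat (k : ℕ) (F : Measure ℝ) [IsProbabilityMeasure F] :
    MeasurePreserving (fun p : (ℕ → ℝ) × (ℕ → ℝ) => concat k p.1 p.2)
      ((Measure.infinitePi fun _ : ℕ => F).prod (Measure.infinitePi fun _ : ℕ => F))
      (Measure.infinitePi fun _ : ℕ => F) := by
  refine ⟨measurable_concat k, Measure.eq_infinitePi _ fun s t ht => ?_⟩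
  rw [Measure.map_apply (measurable_concat k) (.pi s.countable_toSet fun _ _ => ht _)]
  have hpre : (fun p : (ℕ → ℝ) × (ℕ → ℝ) => concat k p.1 p.2) ⁻¹' (Set.pi s t) =
      (Set.pi ((s.filter (· < k) : Finset ℕ) : Set ℕ) t) ×ˢ
      (Set.pi (((s.filter fun i => ¬ i < k).image (· - k) : Finset ℕ) : Set ℕ)
        fun i => t (i + k)) := by
    ext p
    simp only [Set.mem_preimage, Set.mem_pi, Finset.mem_coe, Set.mem_prod, Finset.mem_filter,
      Finset.mem_image, concat]
    constructor
    · refine fun h => ⟨fun i hi => by simpa [hi.2] using h i hi.1, ?_⟩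
      rintro _ ⟨i, hi, rfl⟩
      have := h i hi.1
      rw [if_neg hi.2] at this
      rwa [Nat.sub_add_cancel (not_lt.1 hi.2)]
    · rintro ⟨h1, h2⟩ i hi
      split_ifs with hk
      · exact h1 i ⟨hi, hk⟩
      · have := h2 (i - k) ⟨i, ⟨hi, hk⟩, rfl⟩
        rwa [Nat.sub_add_cancel (not_lt.1 hk)] at this
  rw [hpre, Measure.prod_prod, Measure.infinitePi_pi _ fun i _ => ht i,
    Measure.infinitePi_pi _ fun i _ => ht (i + k), Finset.prod_image,
    ← Finset.prod_filter_mul_prod_filter_not s (· < k)]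
  · congr 1
    refine Finset.prod_congr rfl fun i hi => ?_
    rw [Nat.sub_add_cancel (not_lt.1 (Finset.mem_filter.1 hi).2)]
  · intro i hi j hj hij
    have h1 := (Finset.mem_filter.1 hi).2
    have h2 := (Finset.mem_filter.1 hj).2
    simp only at hij
    omega

lemma measurePreserving_prodProdProdComm {α β γ δ : Type*} [MeasurableSpace α]
    [MeasurableSpace β] [MeasurableSpace γ] [MeasurableSpace δ] (a : Measure α) (b : Measure β)
    (c : Measure γ) (d : Measure δ) [SFinite a] [SFinite b] [SFinite c] [SFinite d] :
    MeasurePreserving (fun p : (α × β) × (γ × δ) => ((p.1.1, p.2.1), (p.1.2, p.2.2)))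
      ((a.prod b).prod (c.prod d)) ((a.prod c).prod (b.prod d)) := by
  have h1 := measurePreserving_prodAssoc a b (c.prod d)
  have h2 := (MeasurePreserving.id a).prod
    (measurePreserving_prodAssoc b c d).symm
  have h3 := (MeasurePreserving.id a).prod
    ((Measure.measurePreserving_swap (μ := b) (ν := c)).prod (MeasurePreserving.id d))
  have h4 := (MeasurePreserving.id a).prod (measurePreserving_prodAssoc c b d)
  have h5 := (measurePreserving_prodAssoc a c (b.prod d)).symm
  exact h5.comp (h4.comp (h3.comp (h2.comp h1)))

lemma ae_pos {F : Measure ℝ} (hF : F (Set.Iic 0) = 0) : ∀ᵐ x ∂F, 0 < x := by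
  rw [ae_iff]; simpa [Set.Iic] using hF

lemma ae_infinitePi_pos {F : Measure ℝ} [IsProbabilityMeasure F] (hF : F (Set.Iic 0) = 0) :
    ∀ᵐ x ∂(Measure.infinitePi fun _ : ℕ => F), ∀ i, 0 < x i := by
  rw [ae_all_iff]
  intro i
  exact (measurePreserving_eval_infinitePi (fun _ : ℕ => F) i).quasiMeasurePreserving.ae
    (ae_pos hF)

/-! ### Laplace transforms and divergence of the input times. -/

/-- The Laplace transform of a measure on the real line. -/
noncomputable def laplace (F : Measure ℝ) (s : ℝ) : ℝ := ∫ x, Real.exp (-(s * x)) ∂F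

lemma integrable_exp_neg {F : Measure ℝ} [IsFiniteMeasure F] (hF : F (Set.Iic 0) = 0) {s : ℝ}
    (hs : 0 ≤ s) : Integrable (fun x => Real.exp (-(s * x))) F := by
  refine Integrable.of_bound (by fun_prop) 1 ?_
  filter_upwards [ae_pos hF] with x hx
  rw [Real.norm_eq_abs, abs_of_pos (Real.exp_pos _), Real.exp_le_one_iff]
  nlinarith

lemma laplace_nonneg (F : Measure ℝ) (s : ℝ) : 0 ≤ laplace F s :=
  integral_nonneg fun _ => (Real.exp_pos _).le

lemma laplace_lt_one {F : Measure ℝ} [IsProbabilityMeasure F] (hF : F (Set.Iic 0) = 0) {s : ℝ}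
    (hs : 0 < s) : laplace F s < 1 := by
  have hi := integrable_exp_neg hF hs.le
  have h : 0 < ∫ x, (1 - Real.exp (-(s * x))) ∂F := by
    rw [integral_pos_iff_support_of_nonneg_ae]
    · have : Function.support (fun x => 1 - Real.exp (-(s * x))) =ᵐ[F] Set.univ := by
        rw [Filter.eventuallyEq_univ]
        filter_upwards [ae_pos hF] with x hx
        have : Real.exp (-(s * x)) < 1 := by rw [Real.exp_lt_one_iff]; nlinarith
        exact sub_ne_zero.2 this.ne'
      rw [measure_congr this]; simp
    · filter_upwards [ae_pos hF] with x hx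
      have : Real.exp (-(s * x)) ≤ 1 := by rw [Real.exp_le_one_iff]; nlinarith
      exact sub_nonneg.2 this
    · exact (integrable_const 1).sub hi
  rw [integral_sub (integrable_const 1) hi] at h
  simp at h
  exact h

lemma integral_infinitePi_prod (F : Measure ℝ) [IsProbabilityMeasure F] (n : ℕ)
    {f : ℕ → ℝ → ℝ} (hf : ∀ i, Measurable (f i)) :
    ∫ x, ∏ i ∈ Finset.range n, f i (x i) ∂(Measure.infinitePi fun _ : ℕ => F) =
      ∏ i ∈ Finset.range n, ∫ x, f i x ∂F := by
  have h : ∀ x : ℕ → ℝ, ∏ i ∈ Finset.range n, f i (x i) =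
      ∏ i : Finset.range n, f i ((Finset.range n).restrict x i) := fun x =>
    (Finset.prod_attach (Finset.range n) fun i => f i (x i)).symm
  simp_rw [h]
  rw [integral_restrict_infinitePi (fun _ : ℕ => F)
      (f := fun y : (i : Finset.range n) → ℝ => ∏ i : Finset.range n, f i (y i)),
    integral_fintype_prod_eq_prod (fun (i : Finset.range n) x => f i x)]
  · exact Finset.prod_attach (Finset.range n) fun i => ∫ x, f i x ∂F
  · have : ∀ i : Finset.range n, Measurable (f i) := fun i => hf i
    exact Measurable.aestronglyMeasurable (by fun_prop)

/-- The last interval carries its own parameter `t` because, at the first reception, the recovery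
time contributes its rate to the first `l` intervals but not always to the last one. -/
lemma integral_exp_inputTimes (F : Measure ℝ) [IsProbabilityMeasure F] (s t : ℝ) (l : ℕ) :
    ∫ τ, Real.exp (-(s * inputTimes τ l)) * Real.exp (-(t * τ l))
      ∂(Measure.infinitePi fun _ : ℕ => F) = laplace F s ^ l * laplace F t := by
  have h := integral_infinitePi_prod F (l + 1)
    (f := fun i x => Real.exp (-((if i < l then s else t) * x))) (by fun_prop)
  rw [Finset.prod_range_succ] at h
  simp only [lt_irrefl, if_false] at h
  rw [Finset.prod_congr rfl (g := fun _ => laplace F s)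
    (fun i hi => by simp [Finset.mem_range.1 hi, laplace])] at h
  rw [Finset.prod_const, Finset.card_range] at h
  rw [laplace.eq_def F t, ← h]
  refine integral_congr_ae (.of_forall fun τ => ?_)
  simp only [Finset.prod_range_succ, lt_irrefl, if_false]
  congr 1
  rw [inputTimes, Finset.mul_sum, ← Finset.sum_neg_distrib, Real.exp_sum]
  exact Finset.prod_congr rfl fun i hi => by simp [Finset.mem_range.1 hi]

lemma integrable_exp_inputTimes {F : Measure ℝ} [IsProbabilityMeasure F]
    (hF : F (Set.Iic 0) = 0) {s t : ℝ} (hs : 0 ≤ s) (ht : 0 ≤ t) (l : ℕ) :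
    Integrable (fun τ => Real.exp (-(s * inputTimes τ l)) * Real.exp (-(t * τ l)))
      (Measure.infinitePi fun _ : ℕ => F) := by
  have := measurable_inputTimes_apply l
  refine Integrable.of_bound (Measurable.aestronglyMeasurable (by fun_prop)) 1 ?_
  filter_upwards [ae_infinitePi_pos hF] with τ h
  rw [Real.norm_eq_abs, ← Real.exp_add, abs_of_pos (Real.exp_pos _), Real.exp_le_one_iff]
  have := mul_nonneg hs (inputTimes_nonneg h l)
  have := mul_nonneg ht (h l).le
  linarith

/-- An exponential Markov bound replaces the law of large numbers and needs no moments: the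
probability that all input times stay below `M` is at most `exp M * laplace F 1 ^ l` for every `l`,
and `laplace F 1 < 1`. -/
lemma ae_isInput {F : Measure ℝ} [IsProbabilityMeasure F] (hF : F (Set.Iic 0) = 0) :
    ∀ᵐ τ ∂(Measure.infinitePi fun _ : ℕ => F), IsInput τ := by
  have hq : laplace F 1 < 1 := laplace_lt_one hF one_pos
  have key : ∀ M : ℕ, ∀ᵐ τ ∂(Measure.infinitePi fun _ : ℕ => F),
      ∃ l, (M : ℝ) < inputTimes τ l := by
    intro M
    set P := Measure.infinitePi fun _ : ℕ => F
    have hle : ∀ l, P.real {τ | ∀ l, inputTimes τ l ≤ M} ≤ Real.exp M * laplace F 1 ^ l := by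
      intro l
      have hint := integrable_exp_inputTimes hF zero_le_one le_rfl l
      have hval := integral_exp_inputTimes F 1 0 l
      have h1 := mul_meas_ge_le_integral_of_nonneg
        (.of_forall fun τ => by positivity) hint (Real.exp (-M))
      rw [hval] at h1
      have h0 : laplace F 0 = 1 := by simp [laplace]
      rw [h0, mul_one] at h1
      have h2 : P.real {τ | ∀ l, inputTimes τ l ≤ M} ≤ P.real {τ | Real.exp (-M) ≤
          Real.exp (-(1 * inputTimes τ l)) * Real.exp (-(0 * τ l))} := by
        refine measureReal_mono fun τ hτ => ?_
        have : inputTimes τ l ≤ M := hτ l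
        simpa using this
      have h3 : Real.exp M * Real.exp (-M) = 1 := by rw [← Real.exp_add]; simp
      calc _ ≤ _ := h2
        _ = Real.exp M * (Real.exp (-M) * _) := by rw [← mul_assoc, h3, one_mul]
        _ ≤ _ := by gcongr
    have hlim : Filter.Tendsto (fun l => Real.exp M * laplace F 1 ^ l) Filter.atTop
        (nhds (Real.exp M * 0)) :=
      (tendsto_pow_atTop_nhds_zero_of_lt_one (laplace_nonneg F 1) hq).const_mul _
    have h0 := ge_of_tendsto' hlim hle
    rw [mul_zero] at h0
    have h1 := le_antisymm h0 measureReal_nonneg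
    rw [measureReal_eq_zero_iff] at h1
    rw [ae_iff]
    simpa using h1
  filter_upwards [ae_infinitePi_pos hF, ae_all_iff.2 key] with τ h1 h2
  refine ⟨h1, fun M => ?_⟩
  obtain ⟨n, hn⟩ := exists_nat_ge M
  obtain ⟨l, hl⟩ := h2 n
  exact ⟨l, hn.trans_lt hl⟩

/-! ### Exponential laws and almost sure partitions. -/

lemma expMeasure_Iic_zero {ρ : ℝ} (hρ : 0 < ρ) : expMeasure ρ (Set.Iic 0) = 0 := by
  have := isProbabilityMeasure_expMeasure hρ
  rw [← ofReal_cdf, cdf_expMeasure_eq hρ]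
  simp

lemma expMeasure_Ico {ρ : ℝ} (hρ : 0 < ρ) {a b : ℝ} (ha : 0 ≤ a) (hab : a ≤ b) :
    expMeasure ρ (Set.Ico a b) =
      ENNReal.ofReal (Real.exp (-(ρ * a)) - Real.exp (-(ρ * b))) := by
  have := isProbabilityMeasure_expMeasure hρ
  have hac : expMeasure ρ ≪ volume := withDensity_absolutelyContinuous _ _
  have hnull : ∀ x, expMeasure ρ {x} = 0 := fun x => hac (by simp)
  have : NullSingletonClass (expMeasure ρ) := ⟨hnull⟩
  rw [measure_congr Ico_ae_eq_Ioc]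
  conv_lhs => rw [← measure_cdf (expMeasure ρ)]
  rw [StieltjesFunction.measure_Ioc, cdf_expMeasure_eq hρ, cdf_expMeasure_eq hρ, if_pos ha,
    if_pos (ha.trans hab)]
  congr 1
  ring

lemma lintegral_eq_tsum_of_existsUnique {α : Type*} [MeasurableSpace α] {μ : Measure α}
    {A : ℕ → Set α} (hA : ∀ l, MeasurableSet (A l)) (h : ∀ᵐ x ∂μ, ∃! l, x ∈ A l)
    {f : α → ℝ≥0∞} (hf : Measurable f) :
    ∫⁻ x, f x ∂μ = ∑' l, ∫⁻ x in A l, f x ∂μ := by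
  simp_rw [← lintegral_indicator (hA _)]
  rw [← lintegral_tsum fun l => (hf.indicator (hA l)).aemeasurable]
  refine lintegral_congr_ae ?_
  filter_upwards [h] with x ⟨l, hl, hu⟩
  rw [tsum_eq_single l, Set.indicator_of_mem hl]
  exact fun k hk => Set.indicator_of_notMem (fun hx => hk (hu k hx)) _

lemma measure_eq_tsum_of_existsUnique {α : Type*} [MeasurableSpace α] {μ : Measure α}
    {A : ℕ → Set α} (hA : ∀ l, MeasurableSet (A l)) (h : ∀ᵐ x ∂μ, ∃! l, x ∈ A l) (W : Set α) :
    μ W = ∑' l, μ (A l ∩ W) := by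
  have := lintegral_eq_tsum_of_existsUnique hA (ae_restrict_of_ae (s := W) h)
    (f := fun _ => 1) measurable_const
  simpa [Measure.restrict_apply (hA _)] using this

/-! ### The output of a single node: domination and renewal. -/

/-- Joint law of the input intervals and the recovery times of a single node. -/
noncomputable def singleLaw (F : Measure ℝ) (ρ : ℝ) : Measure ((ℕ → ℝ) × (ℕ → ℝ)) :=
  (Measure.infinitePi fun _ : ℕ => F).prod (Measure.infinitePi fun _ : ℕ => expMeasure ρ)

/-- Law of the first reception time of a single node. -/
noncomputable def nodeLaw (F : Measure ℝ) (ρ : ℝ) : Measure ℝ :=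
  (singleLaw F ρ).map fun p => intervals p.1 p.2 0

section

variable {F : Measure ℝ} [IsProbabilityMeasure F] {ρ : ℝ}

lemma isProbabilityMeasure_singleLaw (hρ : 0 < ρ) : IsProbabilityMeasure (singleLaw F ρ) := by
  have := isProbabilityMeasure_expMeasure hρ
  unfold singleLaw
  infer_instance

lemma measurable_intervals_apply (j : ℕ) :
    Measurable fun p : (ℕ → ℝ) × (ℕ → ℝ) => intervals p.1 p.2 j :=
  (measurable_pi_apply j).comp measurable_intervals

lemma isProbabilityMeasure_nodeLaw (hρ : 0 < ρ) : IsProbabilityMeasure (nodeLaw F ρ) := by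
  have := isProbabilityMeasure_singleLaw (F := F) hρ
  exact Measure.isProbabilityMeasure_map (measurable_intervals_apply 0).aemeasurable

lemma ae_singleLaw (hF : F (Set.Iic 0) = 0) (hρ : 0 < ρ) :
    ∀ᵐ p ∂(singleLaw F ρ), IsInput p.1 ∧ ∀ j, 0 < p.2 j := by
  have := isProbabilityMeasure_expMeasure hρ
  have h1 := (Measure.quasiMeasurePreserving_fst
    (μ := Measure.infinitePi fun _ : ℕ => F)
    (ν := Measure.infinitePi fun _ : ℕ => expMeasure ρ)).ae (ae_isInput hF)
  have h2 := (Measure.quasiMeasurePreserving_snd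
    (μ := Measure.infinitePi fun _ : ℕ => F)
    (ν := Measure.infinitePi fun _ : ℕ => expMeasure ρ)).ae
    (ae_infinitePi_pos (expMeasure_Iic_zero hρ))
  filter_upwards [h1, h2] with p a b using ⟨a, b⟩

lemma ae_existsUnique_firstReceived (hF : F (Set.Iic 0) = 0) (hρ : 0 < ρ) :
    ∀ᵐ p ∂(singleLaw F ρ), ∃! l, p ∈ {p : (ℕ → ℝ) × (ℕ → ℝ) | FirstReceived l p.1 (p.2 0)} := by
  filter_upwards [ae_singleLaw hF hρ] with p hp
    using hp.1.existsUnique_firstReceived (hp.2 0).le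

lemma ae_interval_ge (hF : F (Set.Iic 0) = 0) (hρ : 0 < ρ) :
    ∀ᵐ p ∂(singleLaw F ρ), p.1 0 ≤ intervals p.1 p.2 0 := by
  filter_upwards [ae_singleLaw hF hρ] with p hp
  obtain ⟨l, hl, -⟩ := hp.1.existsUnique_firstReceived (hp.2 0).le
  rw [intervals_zero, nodeReceptions_one hp.1.1 hl]
  have := (inputTimes_strictMono hp.1.1).monotone (Nat.le_add_left 1 l)
  rwa [inputTimes_succ, inputTimes_zero, zero_add] at this

lemma nodeLaw_Iic_zero (hF : F (Set.Iic 0) = 0) (hρ : 0 < ρ) :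
    nodeLaw F ρ (Set.Iic 0) = 0 := by
  rw [nodeLaw, Measure.map_apply (measurable_intervals_apply 0) measurableSet_Iic]
  have : ∀ᵐ p ∂(singleLaw F ρ), ¬ intervals p.1 p.2 0 ≤ 0 := by
    filter_upwards [ae_singleLaw hF hρ, ae_interval_ge hF hρ] with p h1 h2
    exact not_le.2 ((h1.1.1 0).trans_le h2)
  simpa only [ae_iff, not_not] using! this

/-- Adding a node enlarges the interval distribution of the signals. -/
lemma stochLE_nodeLaw (hF : F (Set.Iic 0) = 0) (hρ : 0 < ρ) : StochLE F (nodeLaw F ρ) := by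
  intro x
  have := isProbabilityMeasure_expMeasure hρ
  have := isProbabilityMeasure_singleLaw (F := F) hρ
  have := isProbabilityMeasure_nodeLaw (F := F) hρ
  rw [cdf_eq_real, cdf_eq_real]
  have hm : MeasurePreserving (fun p : (ℕ → ℝ) × (ℕ → ℝ) => p.1 0) (singleLaw F ρ) F :=
    (measurePreserving_eval_infinitePi (fun _ : ℕ => F) 0).comp measurePreserving_fst
  rw [nodeLaw, map_measureReal_apply (measurable_intervals_apply 0) measurableSet_Iic]
  conv_rhs => rw [← hm.map_eq]
  rw [map_measureReal_apply hm.measurable measurableSet_Iic]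
  refine ENNReal.toReal_mono (measure_ne_top _ _) (measure_mono_ae ?_)
  filter_upwards [ae_interval_ge hF hρ] with p hp hx
  exact hp.trans hx

lemma measurePreserving_concat_prod (hρ : 0 < ρ) (k k' : ℕ) :
    MeasurePreserving (fun p : ((ℕ → ℝ) × (ℕ → ℝ)) × ((ℕ → ℝ) × (ℕ → ℝ)) =>
      (concat k p.1.1 p.2.1, concat k' p.1.2 p.2.2))
      ((singleLaw F ρ).prod (singleLaw F ρ)) (singleLaw F ρ) := by
  have := isProbabilityMeasure_expMeasure hρ
  exact ((measurePreserving_concat k F).prod (measurePreserving_concat k' (expMeasure ρ))).comp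
    (measurePreserving_prodProdProdComm _ _ _ _)

/-- The system regenerates at the first reception: the intervals after it are independent of
the first interval and have the same joint law as all intervals. -/
lemma singleLaw_intervals_cons (hF : F (Set.Iic 0) = 0) (hρ : 0 < ρ) {t : Set ℝ}
    (ht : MeasurableSet t) {V : Set (ℕ → ℝ)} (hV : MeasurableSet V) :
    singleLaw F ρ {p | intervals p.1 p.2 0 ∈ t ∧ shift 1 (intervals p.1 p.2) ∈ V} =
      nodeLaw F ρ t * singleLaw F ρ {p | intervals p.1 p.2 ∈ V} := by
  have hprob := isProbabilityMeasure_singleLaw (F := F) hρ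
  set P := singleLaw F ρ with hP
  set A : ℕ → Set ((ℕ → ℝ) × (ℕ → ℝ)) := fun l => {p | FirstReceived l p.1 (p.2 0)} with hA
  set U : ℕ → Set ((ℕ → ℝ) × (ℕ → ℝ)) :=
    fun l => A l ∩ {p | inputTimes p.1 (l + 1) ∈ t} with hU
  have hUm : ∀ l, MeasurableSet (U l) := fun l => (measurableSet_firstReceived l).inter
    (((measurable_inputTimes_apply (l + 1)).comp measurable_fst) ht)
  -- The reception index is random, so the event is split according to its value `l`. On each piece
  -- the first interval depends only on `l + 1` input intervals and one recovery time, and the later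
  -- intervals only on the rest.
  have key : ∀ V : Set (ℕ → ℝ), MeasurableSet V →
      P {p | intervals p.1 p.2 0 ∈ t ∧ shift 1 (intervals p.1 p.2) ∈ V} =
        (∑' l, P (U l)) * P {p | intervals p.1 p.2 ∈ V} := by
    intro V hV
    have hVm : MeasurableSet {p : (ℕ → ℝ) × (ℕ → ℝ) | intervals p.1 p.2 ∈ V} :=
      measurable_intervals hV
    rw [measure_eq_tsum_of_existsUnique measurableSet_firstReceived
      (ae_existsUnique_firstReceived hF hρ), ← ENNReal.tsum_mul_right]
    refine tsum_congr fun l => ?_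
    have hc := measurePreserving_concat_prod (F := F) hρ (l + 1) 1
    have hsm : MeasurableSet (U l ∩ {p | intervals (shift (l + 1) p.1) (shift 1 p.2) ∈ V}) :=
      (hUm l).inter ((measurable_intervals.comp
        (((measurable_shift (l + 1)).comp measurable_fst).prodMk
          ((measurable_shift 1).comp measurable_snd))) hV)
    calc _ = P (U l ∩ {p | intervals (shift (l + 1) p.1) (shift 1 p.2) ∈ V}) := by
          refine measure_congr ?_
          filter_upwards [ae_singleLaw hF hρ] with p hp
          refine propext ?_
          change (FirstReceived l p.1 (p.2 0) ∧ intervals p.1 p.2 0 ∈ t ∧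
            shift 1 (intervals p.1 p.2) ∈ V) ↔ ((FirstReceived l p.1 (p.2 0) ∧
            inputTimes p.1 (l + 1) ∈ t) ∧ intervals (shift (l + 1) p.1) (shift 1 p.2) ∈ V)
          rw [and_assoc]
          refine and_congr_right fun hl => ?_
          have h1 : shift 1 (intervals p.1 p.2) = intervals (shift (l + 1) p.1) (shift 1 p.2) :=
            funext fun j => intervals_succ hp.1 (fun j => (hp.2 j).le) hl j
          rw [h1, intervals_zero, nodeReceptions_one hp.1.1 hl]
      _ = (P.prod P) (U l ×ˢ {p | intervals p.1 p.2 ∈ V}) := by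
          rw [← hc.measure_preimage hsm.nullMeasurableSet]
          congr 1
          ext p
          simp only [Set.mem_preimage, Set.mem_inter_iff, Set.mem_prod, Set.mem_ofPred_eq, hU, hA,
            shift_concat, inputTimes_concat le_rfl]
          rw [show concat 1 p.1.2 p.2.2 0 = p.1.2 0 from rfl, firstReceived_concat]
      _ = _ := Measure.prod_prod _ _
  rw [key V hV]
  -- With `V` the whole space, the sum in `key` is identified as `nodeLaw F ρ t`.
  have h1 := key Set.univ .univ
  simp only [Set.mem_univ, and_true, Set.ofPred_true, measure_univ, mul_one] at h1
  rw [← h1, nodeLaw, Measure.map_apply (measurable_intervals_apply 0) ht]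
  rfl

lemma singleLaw_intervals_box (hF : F (Set.Iic 0) = 0) (hρ : 0 < ρ) (n : ℕ) {t : ℕ → Set ℝ}
    (ht : ∀ i, MeasurableSet (t i)) :
    singleLaw F ρ {p | ∀ i < n, intervals p.1 p.2 i ∈ t i} =
      ∏ i ∈ Finset.range n, nodeLaw F ρ (t i) := by
  have hprob := isProbabilityMeasure_singleLaw (F := F) hρ
  induction n generalizing t with
  | zero => simp
  | succ n ih =>
    have hV : MeasurableSet {d : ℕ → ℝ | ∀ i < n, d i ∈ t (i + 1)} := by
      simp only [Set.ofPred_forall]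
      exact .iInter fun i => .iInter fun _ => measurable_pi_apply i (ht _)
    have := singleLaw_intervals_cons hF hρ (ht 0) hV
    simp only [Set.mem_ofPred_eq] at this
    rw [ih fun i => ht (i + 1)] at this
    rw [Finset.prod_range_succ', mul_comm, ← this]
    congr 1
    ext p
    simp only [Set.mem_ofPred_eq, shift]
    constructor
    · exact fun h => ⟨h 0 (by omega), fun i hi => h (i + 1) (by omega)⟩
    · rintro ⟨h0, h⟩ (_ | i) hi
      · exact h0
      · exact h i (by omega)

/-- The successive receptions of a node form a renewal process. -/
lemma measurePreserving_intervals (hF : F (Set.Iic 0) = 0) (hρ : 0 < ρ) :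
    have := isProbabilityMeasure_nodeLaw (F := F) hρ
    MeasurePreserving (fun p : (ℕ → ℝ) × (ℕ → ℝ) => intervals p.1 p.2) (singleLaw F ρ)
      (Measure.infinitePi fun _ : ℕ => nodeLaw F ρ) := by
  intro this
  refine ⟨measurable_intervals, Measure.eq_infinitePi _ fun s t ht => ?_⟩
  classical
  rw [Measure.map_apply measurable_intervals (.pi s.countable_toSet fun _ _ => ht _)]
  obtain ⟨n, hn⟩ : ∃ n, s ⊆ Finset.range n := ⟨_, s.subset_range_sup_succ⟩
  have := singleLaw_intervals_box hF hρ n (t := fun i => if i ∈ s then t i else Set.univ)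
    (fun i => by split_ifs; exacts [ht i, .univ])
  rw [← Finset.prod_subset hn (f := fun i => nodeLaw F ρ (if i ∈ s then t i else Set.univ))
    (fun i _ hi => by simp [hi]),
    Finset.prod_congr rfl (g := fun i => nodeLaw F ρ (t i)) fun i hi => by simp [hi]] at this
  rw [← this]
  congr 1
  ext p
  simp only [Set.mem_preimage, Set.mem_pi, Finset.mem_coe, Set.mem_ofPred_eq]
  constructor
  · intro h i _
    split_ifs with hi
    exacts [h i hi, trivial]
  · intro h i hi
    have := h i (Finset.mem_range.1 (hn hi))
    rwa [if_pos hi] at this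

end

/-! ### Removing the node at the input end. -/

section

variable {F : Measure ℝ} [IsProbabilityMeasure F]

lemma measurePreserving_fin_cons {m : ℕ} {r : ℝ} {ρ : Fin m → ℝ} (hr : 0 < r)
    (hρ : ∀ i, 0 < ρ i) :
    MeasurePreserving (fun e : Fin (m + 1) → ℕ → ℝ => (e 0, Fin.tail e))
      (recoveryLaw (Fin.cons r ρ : Fin (m + 1) → ℝ))
      ((Measure.infinitePi fun _ : ℕ => expMeasure r).prod (recoveryLaw ρ)) := by
  have h : ∀ i, IsProbabilityMeasure (expMeasure ((Fin.cons r ρ : Fin (m + 1) → ℝ) i)) :=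
    Fin.cases (isProbabilityMeasure_expMeasure hr)
      fun i => isProbabilityMeasure_expMeasure (hρ i)
  exact measurePreserving_piFinSuccAbove (fun i => Measure.infinitePi fun _ : ℕ =>
    expMeasure ((Fin.cons r ρ : Fin (m + 1) → ℝ) i)) 0

/-- The reception intervals of the input node are i.i.d. with law `nodeLaw F r` and independent of
the other recovery times, so they serve as input intervals for the rest of the line. -/
lemma interreception_cons (hF : F (Set.Iic 0) = 0) {m : ℕ} {r : ℝ} {ρ : Fin m → ℝ}
    (hr : 0 < r) (hρ : ∀ i, 0 < ρ i) :
    interreception F (Fin.cons r ρ : Fin (m + 1) → ℝ) = interreception (nodeLaw F r) ρ := by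
  have := isProbabilityMeasure_expMeasure hr
  have := isProbabilityMeasure_nodeLaw (F := F) hr
  have := isProbabilityMeasure_recoveryLaw hρ
  have := isProbabilityMeasure_singleLaw (F := F) hr
  have h0 := isProbabilityMeasure_recoveryLaw (ρ := (Fin.cons r ρ : Fin (m + 1) → ℝ))
    (Fin.cases hr hρ)
  have h1 := (MeasurePreserving.id (Measure.infinitePi fun _ : ℕ => F)).prod
    (measurePreserving_fin_cons hr hρ)
  have h2 := (measurePreserving_prodAssoc (Measure.infinitePi fun _ : ℕ => F)
    (Measure.infinitePi fun _ : ℕ => expMeasure r) (recoveryLaw ρ)).symm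
  have h3 := (measurePreserving_intervals hF hr).prod (MeasurePreserving.id (recoveryLaw ρ))
  have h4 := h3.comp (h2.comp h1)
  rw [interreception, interreception, systemLaw, systemLaw, ← h4.map_eq,
    Measure.map_map (measurable_lastReceptions_inputTimes 1) h4.measurable]
  congr 1
  ext ω
  simp only [lastReceptions, Function.comp, ← inputTimes_intervals]
  rfl

lemma permanentInterreception_cons {m : ℕ} {r : ℝ} {ρ : Fin m → ℝ} (hr : 0 < r)
    (hρ : ∀ i, 0 < ρ i) :
    permanentInterreception (Fin.cons r ρ : Fin (m + 1) → ℝ) =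
      interreception (expMeasure r) ρ := by
  have h := measurePreserving_fin_cons hr hρ
  rw [permanentInterreception, interreception, systemLaw, ← h.map_eq,
    Measure.map_map (measurable_lastReceptions_inputTimes 1) h.measurable]
  rfl

end

/-! ### Uniqueness of Laplace transforms. -/

/-- The function `x ↦ exp (-x)` on the nonnegative half-line. -/
noncomputable def expNegBCF : NNReal →ᵇ ℝ :=
  BoundedContinuousFunction.mkOfBound ⟨fun x => Real.exp (-(x : ℝ)), by fun_prop⟩ 2 fun x y => by
    have h : ∀ z : NNReal, Real.exp (-(z : ℝ)) ∈ Set.Icc 0 1 := fun z =>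
      ⟨(Real.exp_pos _).le, Real.exp_le_one_iff.2 (neg_nonpos.2 z.2)⟩
    have h1 := h x
    have h2 := h y
    rw [Real.dist_eq, abs_le]
    constructor <;> simp only [ContinuousMap.coe_mk] <;> linarith [h1.1, h1.2, h2.1, h2.2]

lemma expNegBCF_apply (x : NNReal) : expNegBCF x = Real.exp (-(x : ℝ)) := rfl

/-- Finite measures on the nonnegative half-line are determined by their Laplace transforms. -/
lemma ext_nnreal_of_integral_exp {P Q : Measure NNReal} [IsFiniteMeasure P] [IsFiniteMeasure Q]
    (h : ∀ n : ℕ, ∫ x, Real.exp (-(n * (x : ℝ))) ∂P = ∫ x, Real.exp (-(n * (x : ℝ))) ∂Q) :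
    P = Q := by
  -- The polynomials in `exp (-x)` form an algebra that separates points, since `exp (-x)` alone
  -- does; their integrals are combinations of Laplace transforms at natural numbers.
  let A : StarSubalgebra ℝ (NNReal →ᵇ ℝ) :=
    { (Polynomial.aeval (R := ℝ) expNegBCF).range with
      star_mem' := fun {a} ha => by
        have : star a = a := by ext; simp
        rwa [this] }
  refine ext_of_forall_mem_subalgebra_integral_eq_of_pseudoEMetric_complete_countable
    (𝕜 := ℝ) (A := A) ?_ ?_
  · intro x y hxy
    refine ⟨fun x => expNegBCF x, ⟨(expNegBCF : C(NNReal, ℝ)),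
      ⟨expNegBCF, ⟨Polynomial.X, by simp⟩, rfl⟩, rfl⟩, ?_⟩
    simp only [expNegBCF_apply]
    intro he
    exact hxy (NNReal.coe_injective (neg_injective (Real.exp_injective he)))
  · rintro _ ⟨p, rfl⟩
    change ∫ x, (Polynomial.aeval expNegBCF p : NNReal →ᵇ ℝ) x ∂P =
      ∫ x, (Polynomial.aeval expNegBCF p : NNReal →ᵇ ℝ) x ∂Q
    induction p using Polynomial.induction_on' with
    | add p q hp hq =>
      simp only [map_add, BoundedContinuousFunction.add_apply]
      rw [integral_add (BoundedContinuousFunction.integrable _ _)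
        (BoundedContinuousFunction.integrable _ _),
        integral_add (BoundedContinuousFunction.integrable _ _)
        (BoundedContinuousFunction.integrable _ _), hp, hq]
    | monomial n a =>
      have : ∀ x : NNReal, (Polynomial.aeval expNegBCF (Polynomial.monomial n a) : NNReal →ᵇ ℝ) x =
          a * Real.exp (-(n * (x : ℝ))) := fun x => by
        rw [Polynomial.aeval_monomial, BoundedContinuousFunction.mul_apply,
          BoundedContinuousFunction.pow_apply, expNegBCF_apply, ← Real.exp_nat_mul]
        simp
      simp_rw [this]
      rw [integral_const_mul, integral_const_mul, h]

/-- Distributions on the positive half-line are determined by their Laplace transforms. -/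
lemma ext_of_laplace {F G : Measure ℝ} [IsProbabilityMeasure F] [IsProbabilityMeasure G]
    (hF : F (Set.Iic 0) = 0) (hG : G (Set.Iic 0) = 0)
    (h : ∀ s, 0 < s → laplace F s = laplace G s) : F = G := by
  -- The laws are moved to `NNReal` and back, since `exp (-x)` is bounded only on a half-line.
  have hmap : ∀ H : Measure ℝ, H (Set.Iic 0) = 0 →
      (H.map Real.toNNReal).map ((↑) : NNReal → ℝ) = H := fun H hH => by
    rw [Measure.map_map (by fun_prop) (by fun_prop)]
    conv_rhs => rw [← Measure.map_id (μ := H)]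
    refine Measure.map_congr ?_
    filter_upwards [ae_pos hH] with x hx
    exact Real.coe_toNNReal x hx.le
  have hint : ∀ H : Measure ℝ, H (Set.Iic 0) = 0 → ∀ n : ℕ,
      ∫ x, Real.exp (-(n * (x : ℝ))) ∂(H.map Real.toNNReal) = laplace H n := fun H hH n => by
    rw [integral_map (by fun_prop) (Measurable.aestronglyMeasurable (by fun_prop)), laplace]
    refine integral_congr_ae ?_
    filter_upwards [ae_pos hH] with x hx
    rw [Real.coe_toNNReal x hx.le]
  rw [← hmap F hF, ← hmap G hG]
  have := Measure.isProbabilityMeasure_map (μ := F) (f := Real.toNNReal) (by fun_prop)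
  have := Measure.isProbabilityMeasure_map (μ := G) (f := Real.toNNReal) (by fun_prop)
  congr 1
  refine ext_nnreal_of_integral_exp fun n => ?_
  rw [hint F hF, hint G hG]
  rcases Nat.eq_zero_or_pos n with rfl | hn
  · simp [laplace]
  · exact h n (by exact_mod_cast hn)

/-! ### The Laplace transform of a node and commutation of nodes. -/

section

variable {F : Measure ℝ} [IsProbabilityMeasure F] {ρ : ℝ}

/-- Given the input, the recovery time falls between the `l`-th and the next input time with
probability equal to a difference of two exponentials. Integrating over the i.i.d. intervals then
factorizes. -/
lemma setLIntegral_firstReceived (hF : F (Set.Iic 0) = 0) (hρ : 0 < ρ) {s : ℝ} (hs : 0 ≤ s)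
    (l : ℕ) :
    ∫⁻ p in {p | FirstReceived l p.1 (p.2 0)},
      ENNReal.ofReal (Real.exp (-(s * inputTimes p.1 (l + 1)))) ∂(singleLaw F ρ) =
      ENNReal.ofReal ((laplace F s - laplace F (s + ρ)) * laplace F (s + ρ) ^ l) := by
  have := isProbabilityMeasure_expMeasure hρ
  have hm := measurable_inputTimes_apply (l + 1)
  rw [← lintegral_indicator (measurableSet_firstReceived l), singleLaw, lintegral_prod]
  swap
  · refine (Measurable.indicator ?_ (measurableSet_firstReceived l)).aemeasurable
    fun_prop
  have hinner : ∀ᵐ τ ∂(Measure.infinitePi fun _ : ℕ => F),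
      ∫⁻ e, Set.indicator {p : (ℕ → ℝ) × (ℕ → ℝ) | FirstReceived l p.1 (p.2 0)}
        (fun p => ENNReal.ofReal (Real.exp (-(s * inputTimes p.1 (l + 1))))) (τ, e)
        ∂(Measure.infinitePi fun _ : ℕ => expMeasure ρ) =
      ENNReal.ofReal (Real.exp (-((s + ρ) * inputTimes τ l)) * Real.exp (-(s * τ l)) -
        Real.exp (-((s + ρ) * inputTimes τ l)) * Real.exp (-((s + ρ) * τ l))) := by
    filter_upwards [ae_infinitePi_pos hF] with τ hτ
    have he : ∀ e : ℕ → ℝ, Set.indicator {p : (ℕ → ℝ) × (ℕ → ℝ) | FirstReceived l p.1 (p.2 0)}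
        (fun p => ENNReal.ofReal (Real.exp (-(s * inputTimes p.1 (l + 1))))) (τ, e) =
        Set.indicator (Function.eval 0 ⁻¹' Set.Ico (inputTimes τ l) (inputTimes τ (l + 1)))
          (fun _ => ENNReal.ofReal (Real.exp (-(s * inputTimes τ (l + 1))))) e := fun e => rfl
    simp_rw [he]
    rw [lintegral_indicator_const (measurable_pi_apply 0 measurableSet_Ico),
      (measurePreserving_eval_infinitePi (fun _ : ℕ => expMeasure ρ) 0).measure_preimage
        measurableSet_Ico.nullMeasurableSet,
      expMeasure_Ico hρ (inputTimes_nonneg hτ l)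
        ((inputTimes_strictMono hτ).monotone (Nat.le_succ l)),
      ← ENNReal.ofReal_mul (Real.exp_pos _).le, mul_sub, ← Real.exp_add, ← Real.exp_add,
      ← Real.exp_add, ← Real.exp_add, inputTimes_succ]
    congr 3 <;> ring
  rw [lintegral_congr_ae hinner, ← ofReal_integral_eq_lintegral_ofReal]
  · rw [integral_sub (integrable_exp_inputTimes hF (by positivity) hs l)
      (integrable_exp_inputTimes hF (by positivity) (by positivity) l),
      integral_exp_inputTimes, integral_exp_inputTimes]
    congr 1
    ring
  · exact (integrable_exp_inputTimes hF (by positivity) hs l).sub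
      (integrable_exp_inputTimes hF (by positivity) (by positivity) l)
  · filter_upwards [ae_infinitePi_pos hF] with τ hτ
    refine sub_nonneg.2 (mul_le_mul_of_nonneg_left ?_ (Real.exp_pos _).le)
    rw [Real.exp_le_exp]
    nlinarith [mul_pos hρ (hτ l)]

lemma laplace_anti (hF : F (Set.Iic 0) = 0) {s t : ℝ} (hs : 0 ≤ s) (hst : s ≤ t) :
    laplace F t ≤ laplace F s := by
  refine integral_mono_ae (integrable_exp_neg hF (hs.trans hst)) (integrable_exp_neg hF hs) ?_
  filter_upwards [ae_pos hF] with x hx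
  rw [Real.exp_le_exp]
  nlinarith

/-- The terms of `setLIntegral_firstReceived` form a geometric series with ratio `laplace F (s + ρ)
< 1`. Written for `1 - laplace`, the result is a quotient, which makes the composition of nodes easy
to read. -/
lemma one_sub_laplace_nodeLaw (hF : F (Set.Iic 0) = 0) (hρ : 0 < ρ) {s : ℝ} (hs : 0 ≤ s) :
    1 - laplace (nodeLaw F ρ) s = (1 - laplace F s) / (1 - laplace F (s + ρ)) := by
  have hq : laplace F (s + ρ) < 1 := laplace_lt_one hF (by positivity)
  have hq0 := laplace_nonneg F (s + ρ)
  have hd : 0 ≤ laplace F s - laplace F (s + ρ) :=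
    sub_nonneg.2 (laplace_anti hF hs (by linarith))
  have hg := (hasSum_geometric_of_lt_one hq0 hq).mul_left (laplace F s - laplace F (s + ρ))
  have hlap : laplace (nodeLaw F ρ) s =
      (laplace F s - laplace F (s + ρ)) * (1 - laplace F (s + ρ))⁻¹ := by
    have hm0 := measurable_intervals_apply 0
    rw [laplace, integral_eq_lintegral_of_nonneg_ae (.of_forall fun _ => (Real.exp_pos _).le)
      (by fun_prop), nodeLaw, lintegral_map (by fun_prop) hm0,
      lintegral_eq_tsum_of_existsUnique measurableSet_firstReceived
        (ae_existsUnique_firstReceived hF hρ) (by fun_prop)]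
    have hterm : ∀ l : ℕ, ∫⁻ p in {p | FirstReceived l p.1 (p.2 0)},
        ENNReal.ofReal (Real.exp (-(s * intervals p.1 p.2 0))) ∂(singleLaw F ρ) =
        ENNReal.ofReal ((laplace F s - laplace F (s + ρ)) * laplace F (s + ρ) ^ l) := by
      intro l
      rw [← setLIntegral_firstReceived hF hρ hs l]
      refine setLIntegral_congr_fun_ae (measurableSet_firstReceived l) ?_
      filter_upwards [ae_singleLaw hF hρ] with p hp hl
      rw [intervals_zero, nodeReceptions_one hp.1.1 hl]
    simp_rw [hterm]
    rw [← ENNReal.ofReal_tsum_of_nonneg (fun l => by positivity) hg.summable, hg.tsum_eq,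
      ENNReal.toReal_ofReal (mul_nonneg hd (inv_nonneg.2 (by linarith)))]
  rw [hlap]
  have : 1 - laplace F (s + ρ) ≠ 0 := by linarith
  field_simp
  ring

/-- With `φ = laplace F`, both sides have `1 - laplace` equal to `(1 - φ s) (1 - φ (s + a + b)) /
((1 - φ (s + a)) (1 - φ (s + b)))`. -/
lemma nodeLaw_comm (hF : F (Set.Iic 0) = 0) {a b : ℝ} (ha : 0 < a) (hb : 0 < b) :
    nodeLaw (nodeLaw F a) b = nodeLaw (nodeLaw F b) a := by
  have := isProbabilityMeasure_nodeLaw (F := F) ha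
  have := isProbabilityMeasure_nodeLaw (F := F) hb
  have := isProbabilityMeasure_nodeLaw (F := nodeLaw F a) hb
  have := isProbabilityMeasure_nodeLaw (F := nodeLaw F b) ha
  have h1 := nodeLaw_Iic_zero hF ha
  have h2 := nodeLaw_Iic_zero hF hb
  refine ext_of_laplace (nodeLaw_Iic_zero h1 hb) (nodeLaw_Iic_zero h2 ha) fun s hs => ?_
  have e1 := one_sub_laplace_nodeLaw h1 hb hs.le
  have e2 := one_sub_laplace_nodeLaw h2 ha hs.le
  rw [one_sub_laplace_nodeLaw hF ha hs.le, one_sub_laplace_nodeLaw hF ha (by positivity)] at e1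
  rw [one_sub_laplace_nodeLaw hF hb hs.le, one_sub_laplace_nodeLaw hF hb (by positivity)] at e2
  have : 1 - laplace (nodeLaw (nodeLaw F a) b) s = 1 - laplace (nodeLaw (nodeLaw F b) a) s := by
    rw [e1, e2, add_right_comm s b a, div_div_div_eq, div_div_div_eq,
      mul_comm (1 - laplace F (s + a))]
  linarith

lemma laplace_expMeasure {r s : ℝ} (hr : 0 < r) (hs : 0 < s) :
    1 - laplace (expMeasure r) s = s / (s + r) := by
  have hpdf : Measurable (exponentialPDF r) := (measurable_exponentialPDFReal r).ennreal_ofReal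
  have hmul : ∀ x, exponentialPDF r x * ENNReal.ofReal (Real.exp (-(s * x))) =
      ENNReal.ofReal (r / (s + r)) * exponentialPDF (s + r) x := fun x => by
    rw [exponentialPDF_eq, exponentialPDF_eq, ← ENNReal.ofReal_mul' (Real.exp_pos _).le,
      ← ENNReal.ofReal_mul (by positivity)]
    congr 1
    split_ifs
    · rw [mul_assoc, ← Real.exp_add, ← mul_assoc, div_mul_cancel₀ _ (by positivity)]
      congr 2
      ring
    · simp
  have h : laplace (expMeasure r) s = r / (s + r) := by
    rw [laplace, integral_eq_lintegral_of_nonneg_ae (.of_forall fun _ => (Real.exp_pos _).le)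
      (Measurable.aestronglyMeasurable (by fun_prop)),
      show expMeasure r = volume.withDensity (exponentialPDF r) from rfl,
      lintegral_withDensity_eq_lintegral_mul _ hpdf (by fun_prop)]
    simp only [Pi.mul_apply, hmul]
    rw [lintegral_const_mul' _ _ ENNReal.ofReal_ne_top,
      lintegral_exponentialPDF_eq_one (by positivity), mul_one,
      ENNReal.toReal_ofReal (by positivity)]
  rw [h]
  field_simp
  ring

/-- Commutation under permanent input, where the input law itself changes with the order of the
nodes, so `nodeLaw_comm` does not apply. The common value of `1 - laplace` is `s (s + a + b) / ((s +
a) (s + b))`. -/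
lemma nodeLaw_expMeasure_comm {a b : ℝ} (ha : 0 < a) (hb : 0 < b) :
    nodeLaw (expMeasure a) b = nodeLaw (expMeasure b) a := by
  have := isProbabilityMeasure_expMeasure ha
  have := isProbabilityMeasure_expMeasure hb
  have := isProbabilityMeasure_nodeLaw (F := expMeasure a) hb
  have := isProbabilityMeasure_nodeLaw (F := expMeasure b) ha
  have h1 := expMeasure_Iic_zero ha
  have h2 := expMeasure_Iic_zero hb
  refine ext_of_laplace (nodeLaw_Iic_zero h1 hb) (nodeLaw_Iic_zero h2 ha) fun s hs => ?_
  have e1 := one_sub_laplace_nodeLaw h1 hb hs.le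
  have e2 := one_sub_laplace_nodeLaw h2 ha hs.le
  rw [laplace_expMeasure ha hs, laplace_expMeasure ha (by positivity)] at e1
  rw [laplace_expMeasure hb hs, laplace_expMeasure hb (by positivity)] at e2
  have : 1 - laplace (nodeLaw (expMeasure a) b) s = 1 - laplace (nodeLaw (expMeasure b) a) s := by
    rw [e1, e2]
    have : s + a ≠ 0 := by positivity
    have : s + b ≠ 0 := by positivity
    have : s + a + b ≠ 0 := by positivity
    have : s + b + a ≠ 0 := by positivity
    field_simp
    ring
  linarith

lemma interreception_fin_zero (ρ : Fin 0 → ℝ) : interreception F ρ = F := by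
  have := isProbabilityMeasure_recoveryLaw (ρ := ρ) (fun i => i.elim0)
  have hm : MeasurePreserving (fun p : (ℕ → ℝ) × (Fin 0 → ℕ → ℝ) => p.1 0) (systemLaw F ρ) F :=
    (measurePreserving_eval_infinitePi (fun _ : ℕ => F) 0).comp measurePreserving_fst
  rw [interreception]
  conv_rhs => rw [← hm.map_eq]
  congr 1
  ext ω
  simp [lastReceptions, inputTimes]

end

/-! ### Moving the extra node to the output end. -/

/-- Adding a node at the input end enlarges the interreception distribution of the last node. -/
lemma stochLE_interreception_cons {F : Measure ℝ} [IsProbabilityMeasure F]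
    (hF : F (Set.Iic 0) = 0) {r : ℝ} (hr : 0 < r) {m : ℕ} {ρ : Fin m → ℝ} (hρ : ∀ i, 0 < ρ i) :
    StochLE (interreception F ρ) (interreception F (Fin.cons r ρ : Fin (m + 1) → ℝ)) := by
  induction m generalizing F with
  | zero =>
    have := isProbabilityMeasure_nodeLaw (F := F) hr
    rw [interreception_cons hF hr hρ, interreception_fin_zero, interreception_fin_zero]
    exact stochLE_nodeLaw hF hr
  | succ m ih =>
    have := isProbabilityMeasure_nodeLaw (F := F) hr
    have := isProbabilityMeasure_nodeLaw (F := F) (hρ 0)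
    have ht : ∀ i, 0 < Fin.tail ρ i := fun i => hρ i.succ
    -- The induction hypothesis is used with input law `nodeLaw F (ρ 0)`, that is, with the extra
    -- node inserted just after node `0`; commutation then swaps these two.
    have h := ih (nodeLaw_Iic_zero hF (hρ 0)) ht
    rw [interreception_cons (nodeLaw_Iic_zero hF (hρ 0)) hr ht, ← nodeLaw_comm hF hr (hρ 0),
      ← interreception_cons hF (hρ 0) ht,
      ← interreception_cons (nodeLaw_Iic_zero hF hr) (hρ 0) ht, Fin.cons_self_tail,
      ← interreception_cons hF hr hρ] at h
    exact h

lemma stochLE_permanentInterreception_cons {r : ℝ} (hr : 0 < r) {m : ℕ} {ρ : Fin (m + 1) → ℝ}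
    (hρ : ∀ i, 0 < ρ i) :
    StochLE (permanentInterreception ρ)
      (permanentInterreception (Fin.cons r ρ : Fin (m + 2) → ℝ)) := by
  have := isProbabilityMeasure_expMeasure hr
  have := isProbabilityMeasure_expMeasure (hρ 0)
  have ht : ∀ i, 0 < Fin.tail ρ i := fun i => hρ i.succ
  -- Node `0` under permanent input acts as a renewal input with exponential intervals, so the extra
  -- node is first inserted behind it and then exchanged with it.
  have h := stochLE_interreception_cons (expMeasure_Iic_zero (hρ 0)) hr ht
  rw [interreception_cons (expMeasure_Iic_zero (hρ 0)) hr ht,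
    nodeLaw_expMeasure_comm (hρ 0) hr,
    ← interreception_cons (expMeasure_Iic_zero hr) (hρ 0) ht,
    ← permanentInterreception_cons (hρ 0) ht, Fin.cons_self_tail,
    ← permanentInterreception_cons hr hρ] at h
  exact h

end OnOff

theorem lemma5 {m : ℕ} (ρ : Fin (m + 1) → ℝ) (hρ : ∀ i, 0 < ρ i) (r : ℝ) (hr : 0 < r) :
    (∀ F : MeasureTheory.Measure ℝ, MeasureTheory.IsProbabilityMeasure F → F (Set.Iic 0) = 0 →
      OnOff.StochLE (OnOff.interreception F ρ)
        (OnOff.interreception F (Fin.cons r ρ : Fin (m + 2) → ℝ))) ∧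
    OnOff.StochLE (OnOff.permanentInterreception ρ)
      (OnOff.permanentInterreception (Fin.cons r ρ : Fin (m + 2) → ℝ)) := by
  refine ⟨fun F hF hF0 => ?_, OnOff.stochLE_permanentInterreception_cons hr hρ⟩
  exact OnOff.stochLE_interreception_cons hF0 hr hρ
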